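/- A \emph{connectivity function} on a finite set $E$ is a function $\lambda : 2^E \to \mathbb{R}$ with $\lambda(\emptyset)=0$, $\lambda(X)=\lambda(E\setminus X)$ for all $X\subseteq E$, and $\lambda(X\cap Y)+\lambda(X\cup Y)\le\lambda(X)+\lambda(Y)$ for all $X,Y\subseteq E$. For a finite graph $G$ with edge set $E$, the \emph{(vertex-)connectivity function} of $G$ is $\gamma_G(X)=|V(X)|+|V(E\setminus X)|-|V(E)|$ for $X\subseteq E$, where $V(X)$ is the set of vertices incident with some edge in $X$. There is a polynomial $p$ such that for every $n$ and every $n$-element set $E$ there is a deterministic adaptive procedure with the following property: given access to an arbitrary connectivity function $\lambda$ on $E$ only through evaluations $X\mapsto\lambda(X)$ (each evaluated set may depend on the values received before), it makes at most $p(n)$ evaluations of $\lambda$ and then correctly answers whether there is a graph $G$ with edge set $E$ such that $\lambda=\gamma_G$. This holds both when ``graph'' means simple graph and when it means graph in which loops and parallel edges are allowed (with a procedure for each of the two meanings). -/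

import Mathlib

/-- A connectivity function based on the set `E`: a real-valued function on the subsets of `E`
that is normalised, symmetric and submodular. -/
structure IsConnectivityFunction {E : Type*} (lam : Set E → ℝ) : Prop where
  normalised : lam ∅ = 0
  symmetric : ∀ X : Set E, lam X = lam Xᶜ
  submodular : ∀ X Y : Set E, lam (X ∩ Y) + lam (X ∪ Y) ≤ lam X + lam Y

namespace Graph

/-- `V(X)`: the vertices of `G` that are incident with some edge in `X`. -/
def verticesOf {V E : Type*} (G : Graph V E) (X : Set E) : Set V :=
  {v | ∃ e ∈ X, G.Inc e v}

/-- The (vertex-)connectivity function `γ_G(X) = |V(X)| + |V(E - X)| - |V(E)|` of a graph `G`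
whose edge set is all of the type `E`. -/
noncomputable def connectivityFunction {V E : Type*} (G : Graph V E) (X : Set E) : ℝ :=
  ((G.verticesOf X).ncard : ℝ) + ((G.verticesOf Xᶜ).ncard : ℝ)
    - ((G.verticesOf Set.univ).ncard : ℝ)

end Graph

/-- `lam` is the connectivity function of a finite graph with edge set `E`; loops and parallel
edges are allowed. -/
def IsMultigraphic {E : Type*} (lam : Set E → ℝ) : Prop :=
  ∃ (V : Type) (G : Graph V E), G.vertexSet.Finite ∧ G.edgeSet = Set.univ ∧
    lam = G.connectivityFunction

/-- `lam` is the connectivity function of a finite simple graph with edge set `E`. -/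
def IsSimpleGraphic {E : Type*} (lam : Set E → ℝ) : Prop :=
  ∃ (V : Type) (G : Graph V E), G.vertexSet.Finite ∧ G.edgeSet = Set.univ ∧ G.Simple ∧
    lam = G.connectivityFunction

/-- A deterministic adaptive procedure with access to an unknown set function on `E`: it either
stops with a yes/no answer, or evaluates the function at a set `X` and continues in a way that
depends on the value received. -/
inductive EvaluationTree (E : Type*) where
  | answer (b : Bool) : EvaluationTree E
  | evaluate (X : Set E) (next : ℝ → EvaluationTree E) : EvaluationTree E

namespace EvaluationTree

/-- The answer that the procedure gives when it is run on `lam`. -/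
def run {E : Type*} (lam : Set E → ℝ) : EvaluationTree E → Bool
  | answer b => b
  | evaluate X next => run lam (next (lam X))

/-- The number of evaluations of `lam` that the procedure makes when it is run on `lam`. -/
def numEvaluations {E : Type*} (lam : Set E → ℝ) : EvaluationTree E → ℕ
  | answer _ => 0
  | evaluate X next => numEvaluations lam (next (lam X)) + 1

/-- On every connectivity function `lam` on `E`, the procedure makes at most `k` evaluations of
`lam` and answers correctly whether `lam` has the property `P`. -/
def Decides {E : Type*} (T : EvaluationTree E) (P : (Set E → ℝ) → Prop) (k : ℕ) : Prop :=
  ∀ lam : Set E → ℝ, IsConnectivityFunction lam →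
    (T.run lam = true ↔ P lam) ∧ T.numEvaluations lam ≤ k

end EvaluationTree

/-! The value `γ_G(X)` is the number of vertices whose star (set of incident edges) is split by `X`,
and every edge lies in at most two stars. Two facts about such split counts give the theorem.

Determination: the values on sets of size at most 3 determine a split count. Möbius inversion
recovers, for each triple, how many stars strictly contain it. As an edge lies in at most two stars,
the stars containing a larger set are those containing a suitable triple, so all larger containment
counts follow (`splitCount_eq_of_forall_card_le_three`).

Verification: each split count has cubically many test sets on which agreement forces equality with
any connectivity function `f`. At `X`, the marginal of `e` in the split count is at least the one at
some small test set; submodularity of `f` bounds its marginals from above in the same way. So split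
count minus `f` is monotone, and being 0 at both ends it vanishes
(`eq_splitCount_of_forall_testSets`).

The procedure queries all small sets, picks a graphic candidate with these values, and queries the
candidate's test sets. Only evaluations are counted, so finding the candidate is free. -/

open Finset

namespace StarFamily

variable {E ι κ : Type*} [DecidableEq E]

/-- The number of members of the family `s` over `W` that are split by `X`, that is, meet both
`X` and its complement. -/
def splitCount (W : Finset ι) (s : ι → Finset E) (X : Finset E) : ℝ :=
  ∑ w ∈ W, if (s w ∩ X).Nonempty ∧ (s w \ X).Nonempty then 1 else 0

/-- The number of members of the family that contain `X`. -/
def containCount (W : Finset ι) (s : ι → Finset E) (X : Finset E) : ℕ :=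
  #{w ∈ W | X ⊆ s w}

/-- The number of members of the family that are equal to `X`. -/
def equalCount (W : Finset ι) (s : ι → Finset E) (X : Finset E) : ℕ :=
  #{w ∈ W | s w = X}

/-! ### Möbius inversion of split counts -/

lemma sum_powerset_neg_one_pow_disjoint (S X : Finset E) :
    ∑ Y ∈ X.powerset, (-1 : ℝ) ^ #Y * (if Disjoint S Y then 1 else 0) =
      if X ⊆ S then 1 else 0 := by
  have hfilter : X.powerset.filter (fun Y => Disjoint S Y) = (X \ S).powerset := by
    ext Y
    simp [Finset.subset_sdiff, disjoint_comm]
  simp only [mul_ite, mul_one, mul_zero]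
  rw [← Finset.sum_filter, hfilter]
  have h := Finset.sum_powerset_neg_one_pow_card (x := X \ S)
  simp only [Finset.sdiff_eq_empty_iff_subset] at h
  exact_mod_cast congrArg (Int.cast : ℤ → ℝ) h

/-- Complementation `Y ↦ X \ Y` reduces this to the disjoint case, at the cost of the sign `(-1) ^
#X`. -/
lemma sum_powerset_neg_one_pow_subset (S X : Finset E) :
    ∑ Y ∈ X.powerset, (-1 : ℝ) ^ #Y * (if S ⊆ Y then 1 else 0) =
      (-1) ^ #X * if S = X then 1 else 0 := by
  by_cases hSX : S ⊆ X
  · have key : ∑ Y ∈ X.powerset, (-1 : ℝ) ^ #Y * (if S ⊆ Y then 1 else 0) =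
        ∑ Y ∈ X.powerset, (-1) ^ #X * ((-1 : ℝ) ^ #Y * (if Disjoint S Y then 1 else 0)) := by
      refine Finset.sum_nbij' (fun Y => X \ Y) (fun Y => X \ Y) (by simp) (by simp) ?_ ?_ ?_
      · intro Y hY
        exact Finset.sdiff_sdiff_eq_self (Finset.mem_powerset.1 hY)
      · intro Y hY
        exact Finset.sdiff_sdiff_eq_self (Finset.mem_powerset.1 hY)
      · intro Y hY
        have hYX := Finset.mem_powerset.1 hY
        have hiff : Disjoint S (X \ Y) ↔ S ⊆ Y := by
          rw [Finset.disjoint_left]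
          simp only [Finset.mem_sdiff, not_and, not_not]
          exact ⟨fun h a ha => h ha (hSX ha), fun h a ha _ => h ha⟩
        have hsign : (-1 : ℝ) ^ #Y = (-1) ^ #X * (-1) ^ #(X \ Y) := by
          rw [← Finset.card_sdiff_add_card_eq_card hYX, pow_add, mul_assoc, mul_comm, mul_assoc,
            ← pow_add, Even.neg_one_pow ⟨_, rfl⟩, mul_one]
        simp only [hiff]
        rw [hsign, mul_assoc]
    rw [key, ← Finset.mul_sum, sum_powerset_neg_one_pow_disjoint]
    congr 1
    by_cases h : X ⊆ S
    · simp [subset_antisymm hSX h]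
    · have : S ≠ X := fun h' => h h'.symm.subset
      simp [h, this]
  · have h : S ≠ X := fun h => hSX h.subset
    simp only [h, if_false, mul_zero]
    refine Finset.sum_eq_zero fun Y hY => ?_
    rw [if_neg fun h' => hSX (h'.trans (Finset.mem_powerset.1 hY)), mul_zero]

lemma sum_powerset_neg_one_pow_split (S X : Finset E) (hX : X.Nonempty) :
    ∑ Y ∈ X.powerset, (-1 : ℝ) ^ #Y *
        (if (S ∩ Y).Nonempty ∧ (S \ Y).Nonempty then 1 else 0) =
      -((if X ⊆ S then 1 else 0) + (-1) ^ #X * if S = X then 1 else 0) := by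
  -- Inclusion-exclusion; the constant is 2 for empty `S`, which is both disjoint from `Y` and
  -- contained in it. Constants vanish in the alternating sum.
  have hsplit : ∀ Y : Finset E, (if (S ∩ Y).Nonempty ∧ (S \ Y).Nonempty then (1 : ℝ) else 0) =
      (if S = ∅ then 2 else 1) - (if Disjoint S Y then 1 else 0) - (if S ⊆ Y then 1 else 0) := by
    intro Y
    simp only [← Finset.not_disjoint_iff_nonempty_inter, Finset.sdiff_nonempty]
    rcases S.eq_empty_or_nonempty with rfl | hS
    · norm_num
    · have hne := hS.ne_empty
      by_cases h1 : Disjoint S Y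
      · have : ¬ S ⊆ Y := fun h => hne (Finset.disjoint_self_iff_empty S |>.1 (h1.mono_right h))
        simp [h1, this, hne]
      · by_cases h2 : S ⊆ Y <;> simp [h1, h2, hne]
  have hzero : ∑ Y ∈ X.powerset, (-1 : ℝ) ^ #Y = 0 := by
    have h := Finset.sum_powerset_neg_one_pow_card_of_nonempty hX
    exact_mod_cast congrArg (Int.cast : ℤ → ℝ) h
  simp only [hsplit, mul_sub, Finset.sum_sub_distrib]
  rw [sum_powerset_neg_one_pow_disjoint, sum_powerset_neg_one_pow_subset, ← Finset.sum_mul, hzero]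
  ring

lemma sum_powerset_neg_one_pow_splitCount (W : Finset ι) (s : ι → Finset E) (X : Finset E)
    (hX : X.Nonempty) :
    ∑ Y ∈ X.powerset, (-1 : ℝ) ^ #Y * splitCount W s Y =
      -((containCount W s X : ℝ) + (-1) ^ #X * equalCount W s X) := by
  simp only [splitCount, Finset.mul_sum]
  rw [Finset.sum_comm]
  simp only [← Finset.mul_sum, sum_powerset_neg_one_pow_split _ X hX, Finset.sum_neg_distrib,
    Finset.sum_add_distrib, containCount, equalCount, Finset.natCast_card_filter]

/-- If every element lies in at most two members of the family, then the members containing a set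
`K` are those containing a suitable triple of elements of `K`. -/
lemma exists_triple_forall_subset (W : Finset ι) (s : ι → Finset E)
    (hs : ∀ e, #{w ∈ W | e ∈ s w} ≤ 2) (K : Finset E) (hK : 3 ≤ #K) :
    ∃ T ⊆ K, #T = 3 ∧ ∀ w ∈ W, T ⊆ s w → K ⊆ s w := by
  classical
  obtain ⟨e, he⟩ : K.Nonempty := Finset.card_pos.1 (by omega)
  have hmiss : ∀ w, ∃ f ∈ K, f ∈ s w → K ⊆ s w := by
    intro w
    by_cases h : K ⊆ s w
    · exact ⟨e, he, fun _ => h⟩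
    · obtain ⟨f, hf, hfw⟩ := Finset.not_subset.1 h
      exact ⟨f, hf, fun h => absurd h hfw⟩
  choose f hfK hf using hmiss
  -- One element `e`, plus one missed element of `K` for each of the at most two members through
  -- `e`: at most three in all, padded to exactly three.
  obtain ⟨T, hT, hTK, hcard⟩ := Finset.exists_subsuperset_card_eq
    (s := insert e ({w ∈ W | e ∈ s w}.image f)) (t := K) (n := 3)
    (Finset.insert_subset he (Finset.image_subset_iff.2 fun w _ => hfK w))
    ((Finset.card_insert_le _ _).trans (Nat.succ_le_succ (Finset.card_image_le.trans (hs e)))) hK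
  refine ⟨T, hTK, hcard, fun w hw hTw => hf w (hTw (hT ?_))⟩
  refine Finset.mem_insert_of_mem (Finset.mem_image_of_mem _ (Finset.mem_filter.2 ⟨hw, ?_⟩))
  exact hTw (hT (Finset.mem_insert_self _ _))

/-! ### Determination by sets of size at most three -/

section Determination

variable {W : Finset ι} {s : ι → Finset E} {W' : Finset κ} {s' : κ → Finset E}

/-- The sign `(-1) ^ 3` turns the inversion formula into a difference, the number of members
strictly containing `T`. -/
lemma containCount_sub_equalCount_eq
    (h : ∀ X : Finset E, #X ≤ 3 → splitCount W s X = splitCount W' s' X)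
    (T : Finset E) (hT : #T = 3) :
    (containCount W s T : ℝ) - equalCount W s T =
      (containCount W' s' T : ℝ) - equalCount W' s' T := by
  have hne : T.Nonempty := Finset.card_pos.1 (by omega)
  have h1 := sum_powerset_neg_one_pow_splitCount W s T hne
  have h2 := sum_powerset_neg_one_pow_splitCount W' s' T hne
  rw [Finset.sum_congr rfl fun Y hY => by
    rw [h Y ((Finset.card_le_card (Finset.mem_powerset.1 hY)).trans hT.le)], h2, hT] at h1
  linarith

/-- For a triple `T ⊆ K` adapted to the second family, members of the first containing `K` strictly
contain `T`. Both families have equally many strict supersets of `T`, and in the second family these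
all contain `K`. -/
lemma containCount_le
    (hs' : ∀ e, #{w ∈ W' | e ∈ s' w} ≤ 2)
    (h : ∀ X : Finset E, #X ≤ 3 → splitCount W s X = splitCount W' s' X)
    (K : Finset E) (hK : 4 ≤ #K) : containCount W s K ≤ containCount W' s' K := by
  obtain ⟨T, hTK, hT, hTs⟩ := exists_triple_forall_subset W' s' hs' K (by omega)
  have hsub := containCount_sub_equalCount_eq h T hT
  have h1 : containCount W s K + equalCount W s T ≤ containCount W s T := by
    classical
    rw [containCount, equalCount, ← Finset.card_union_of_disjoint]
    · refine Finset.card_le_card fun w hw => ?_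
      simp only [Finset.mem_union, Finset.mem_filter] at hw ⊢
      rcases hw with hw | hw
      · exact ⟨hw.1, hTK.trans hw.2⟩
      · exact ⟨hw.1, hw.2.symm.subset⟩
    · refine Finset.disjoint_filter.2 fun w _ hw hw' => ?_
      have := Finset.card_le_card hw
      rw [hw'] at this
      omega
  have h2 : containCount W' s' T ≤ containCount W' s' K := by
    refine Finset.card_le_card fun w hw => ?_
    simp only [Finset.mem_filter] at hw ⊢
    exact ⟨hw.1, hTs w hw.1 hw.2⟩
  rify at h1 h2 ⊢
  have h3 : (0 : ℝ) ≤ equalCount W' s' T := by positivity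
  linarith

lemma containCount_eq_sum_equalCount [Fintype E] (W : Finset ι) (s : ι → Finset E)
    (X : Finset E) :
    containCount W s X = equalCount W s X + ∑ Y with X ⊂ Y, equalCount W s Y := by
  have hfib := Finset.card_eq_sum_card_fiberwise (s := {w ∈ W | X ⊆ s w}) (f := s)
    (t := insert X ({Y | X ⊂ Y} : Finset (Finset E))) (fun w hw => by
      have hw' := (Finset.mem_filter.1 hw).2
      rcases hw'.eq_or_ssubset with h | h
      · simp [h]
      · simp [h])
  rw [containCount, hfib, Finset.sum_insert (by simp)]
  congr 1
  · rw [equalCount, Finset.filter_filter]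
    congr 1
    ext w
    simp only [Finset.mem_filter]
    exact ⟨fun h => ⟨h.1, h.2.2⟩, fun h => ⟨h.1, h.2.symm.subset, h.2⟩⟩
  · refine Finset.sum_congr rfl fun Y hY => ?_
    have hXY := (Finset.mem_filter.1 hY).2
    rw [equalCount, Finset.filter_filter]
    congr 1
    ext w
    simp only [Finset.mem_filter]
    exact ⟨fun h => ⟨h.1, h.2.2⟩, fun h => ⟨h.1, hXY.subset.trans h.2.symm.subset, h.2⟩⟩

/-- Downward induction: subtract the members strictly containing `X` from those containing it. -/
lemma equalCount_eq [Fintype E]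
    (h : ∀ X : Finset E, 4 ≤ #X → containCount W s X = containCount W' s' X)
    (X : Finset E) (hX : 4 ≤ #X) : equalCount W s X = equalCount W' s' X := by
  induction X using WellFoundedGT.induction with
  | ind X ih =>
    have h1 := containCount_eq_sum_equalCount W s X
    have h2 := containCount_eq_sum_equalCount W' s' X
    have h3 : ∑ Y with X ⊂ Y, equalCount W s Y = ∑ Y with X ⊂ Y, equalCount W' s' Y := by
      refine Finset.sum_congr rfl fun Y hY => ?_
      have hXY := (Finset.mem_filter.1 hY).2
      exact ih Y hXY (hX.trans (Finset.card_le_card hXY.subset))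
    have := h X hX
    omega

/-- A split count of a family in which every element lies in at most two members is determined by
its values on the sets of size at most three. -/
theorem splitCount_eq_of_forall_card_le_three [Fintype E]
    (hs : ∀ e, #{w ∈ W | e ∈ s w} ≤ 2) (hs' : ∀ e, #{w ∈ W' | e ∈ s' w} ≤ 2)
    (h : ∀ X : Finset E, #X ≤ 3 → splitCount W s X = splitCount W' s' X) (X : Finset E) :
    splitCount W s X = splitCount W' s' X := by
  have hcontain : ∀ X : Finset E, 4 ≤ #X → containCount W s X = containCount W' s' X :=
    fun X hX => le_antisymm (containCount_le hs' h X hX)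
      (containCount_le hs (fun X hX => (h X hX).symm) X hX)
  have hequal := equalCount_eq hcontain
  induction X using Finset.strongInduction with
  | H X ih =>
    by_cases hX : #X ≤ 3
    · exact h X hX
    · push Not at hX
      have hne : X.Nonempty := Finset.card_pos.1 (by omega)
      -- Both alternating sums over subsets of `X` agree, and by induction so do all terms except
      -- the one for `X` itself.
      have h1 := sum_powerset_neg_one_pow_splitCount W s X hne
      rw [hcontain X hX, hequal X hX, ← sum_powerset_neg_one_pow_splitCount W' s' X hne,
        ← Finset.add_sum_erase _ _ (Finset.mem_powerset_self X),
        ← Finset.add_sum_erase _ (fun Y => (-1 : ℝ) ^ #Y * splitCount W' s' Y)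
          (Finset.mem_powerset_self X)] at h1
      rw [Finset.sum_congr rfl fun Y hY => by
        rw [ih Y (Finset.mem_ssubsets.1 hY)]] at h1
      exact mul_left_cancel₀ (pow_ne_zero _ (by norm_num)) (add_right_cancel h1)

end Determination

/-! ### Certifying a split count by cubically many values -/

section Verification

/-- The sets `∅`, `{e}` and `s w \ {e}` for `e ∈ s w`. -/
def basicSets [Fintype E] (W : Finset ι) (s : ι → Finset E) : Finset (Finset E) :=
  insert ∅ (univ.image (fun e => {e}) ∪
    univ.biUnion fun e => {w ∈ W | e ∈ s w}.image fun w => s w \ {e})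

/-- The unions of three basic sets. -/
def testSets [Fintype E] (W : Finset ι) (s : ι → Finset E) : Finset (Finset E) :=
  (basicSets W s ×ˢ basicSets W s ×ˢ basicSets W s).image fun A => A.1 ∪ A.2.1 ∪ A.2.2

variable [Fintype E] {W : Finset ι} {s : ι → Finset E}

lemma card_basicSets_le (hs : ∀ e, #{w ∈ W | e ∈ s w} ≤ 2) :
    #(basicSets W s) ≤ 3 * Fintype.card E + 1 := by
  refine (Finset.card_insert_le _ _).trans (Nat.succ_le_succ ((Finset.card_union_le _ _).trans ?_))
  have h1 : #((univ : Finset E).image fun e => ({e} : Finset E)) ≤ Fintype.card E :=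
    Finset.card_image_le
  have h2 : #((univ : Finset E).biUnion fun e =>
      {w ∈ W | e ∈ s w}.image fun w => s w \ {e}) ≤ Fintype.card E * 2 :=
    Finset.card_biUnion_le_card_mul _ _ _ fun e _ => Finset.card_image_le.trans (hs e)
  omega

lemma card_testSets_le (hs : ∀ e, #{w ∈ W | e ∈ s w} ≤ 2) :
    #(testSets W s) ≤ (3 * Fintype.card E + 1) ^ 3 := by
  refine Finset.card_image_le.trans ?_
  rw [Finset.card_product, Finset.card_product]
  calc _ ≤ (3 * Fintype.card E + 1) * ((3 * Fintype.card E + 1) * (3 * Fintype.card E + 1)) := by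
        gcongr <;> exact card_basicSets_le hs
    _ = _ := by ring

lemma empty_mem_basicSets : ∅ ∈ basicSets W s := Finset.mem_insert_self _ _

lemma singleton_mem_basicSets (e : E) : {e} ∈ basicSets W s := by
  simp [basicSets]

lemma sdiff_singleton_mem_basicSets {w : ι} (hw : w ∈ W) {e : E} (he : e ∈ s w) :
    s w \ {e} ∈ basicSets W s := by
  refine Finset.mem_insert_of_mem (Finset.mem_union_right _ (Finset.mem_biUnion.2
    ⟨e, Finset.mem_univ _, Finset.mem_image.2 ⟨w, Finset.mem_filter.2 ⟨hw, he⟩, rfl⟩⟩))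

lemma union_mem_testSets {A B C : Finset E} (hA : A ∈ basicSets W s) (hB : B ∈ basicSets W s)
    (hC : C ∈ basicSets W s) : A ∪ B ∪ C ∈ testSets W s :=
  Finset.mem_image.2 ⟨(A, B, C), by simp [hA, hB, hC], rfl⟩

lemma mem_testSets_of_card_le_three (X : Finset E) (hX : #X ≤ 3) : X ∈ testSets W s := by
  have h0 : ∅ ∈ basicSets W s := empty_mem_basicSets
  have h1 : ∀ e : E, {e} ∈ basicSets W s := singleton_mem_basicSets
  interval_cases hc : #X
  · rw [Finset.card_eq_zero.1 hc]
    exact union_mem_testSets h0 h0 h0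
  · obtain ⟨a, rfl⟩ := Finset.card_eq_one.1 hc
    simpa using union_mem_testSets (h1 a) h0 h0
  · obtain ⟨a, b, -, rfl⟩ := Finset.card_eq_two.1 hc
    exact union_mem_testSets h0 (h1 a) (h1 b)
  · obtain ⟨a, b, c, -, -, -, rfl⟩ := Finset.card_eq_three.1 hc
    rw [Finset.insert_eq, Finset.insert_eq, ← Finset.union_assoc]
    exact union_mem_testSets (h1 a) (h1 b) (h1 c)

/-- For a member `s w` containing `e`, some basic subset `A` of `X` forces the marginal of `e` with
respect to splitting `s w` to be the same at all sets between `A` and `X`. -/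
lemma exists_basicSet_marginal_le {w : ι} (hw : w ∈ W) {e : E} (he : e ∈ s w) (X : Finset E)
    (heX : e ∉ X) :
    ∃ A ∈ basicSets W s, A ⊆ X ∧ ∀ Y : Finset E, A ⊆ Y → Y ⊆ X →
      ((if (s w ∩ insert e Y).Nonempty ∧ (s w \ insert e Y).Nonempty then 1 else 0 : ℝ) -
        if (s w ∩ Y).Nonempty ∧ (s w \ Y).Nonempty then 1 else 0) ≤
      (if (s w ∩ insert e X).Nonempty ∧ (s w \ insert e X).Nonempty then 1 else 0) -
        if (s w ∩ X).Nonempty ∧ (s w \ X).Nonempty then 1 else 0 := by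
  have hins : ∀ Y : Finset E, (s w ∩ insert e Y).Nonempty := fun Y => ⟨e, by simp [he]⟩
  have hdiff : ∀ Y : Finset E, Y ⊆ X → (s w \ Y).Nonempty := fun Y hY =>
    ⟨e, by simp only [Finset.mem_sdiff]; exact ⟨he, fun h => heX (hY h)⟩⟩
  -- If `X` contains the rest of `s w`, requiring `Y` to contain it too makes the marginals equal.
  -- Otherwise, if `s w` meets `X` in `f`, the marginal at `X` is 0, and it is at most 0 once `f ∈
  -- Y`. In the remaining case the marginal at `X` is 1, the largest possible value.
  by_cases hfull : s w \ {e} ⊆ X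
  · refine ⟨_, sdiff_singleton_mem_basicSets hw he, hfull, fun Y hAY hYX => le_of_eq ?_⟩
    have hI : s w ∩ Y = s w ∩ X := by
      ext f
      simp only [Finset.mem_inter]
      refine ⟨fun h => ⟨h.1, hYX h.2⟩, fun h => ⟨h.1, hAY ?_⟩⟩
      simp only [Finset.mem_sdiff, Finset.mem_singleton]
      exact ⟨h.1, fun hfe => heX (hfe ▸ h.2)⟩
    have hD : s w \ insert e Y = s w \ insert e X := by
      ext f
      have := congrArg (f ∈ ·) hI
      simp only [Finset.mem_inter, eq_iff_iff] at this
      simp only [Finset.mem_sdiff, Finset.mem_insert]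
      tauto
    simp only [hins, hdiff Y hYX, hdiff X subset_rfl, hI, hD, true_and, and_true]
  · have hout : (s w \ insert e X).Nonempty := by
      obtain ⟨f, hf, hfX⟩ := Finset.not_subset.1 hfull
      refine ⟨f, ?_⟩
      simp only [Finset.mem_sdiff, Finset.mem_singleton, Finset.mem_insert] at hf ⊢
      tauto
    by_cases hmeet : (s w ∩ X).Nonempty
    · obtain ⟨f, hf⟩ := hmeet
      rw [Finset.mem_inter] at hf
      refine ⟨{f}, singleton_mem_basicSets f, by simpa using hf.2, fun Y hAY hYX => ?_⟩
      have hY : (s w ∩ Y).Nonempty := ⟨f, Finset.mem_inter.2 ⟨hf.1, hAY (by simp)⟩⟩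
      have hX : (s w ∩ X).Nonempty := ⟨f, Finset.mem_inter.2 hf⟩
      simp only [hins, hdiff Y hYX, hdiff X subset_rfl, hY, hX, hout, and_self, if_true, true_and]
      split_ifs <;> norm_num
    · refine ⟨∅, empty_mem_basicSets, by simp, fun Y _ _ => ?_⟩
      simp only [hins, hmeet, hout, and_self, if_true, true_and, false_and, if_false]
      split_ifs <;> norm_num

/-- The marginal of `e` at `X` is attained, up to an inequality, at a test set contained in `X`. -/
lemma exists_testSet_splitCount_marginal_le (hs : ∀ e, #{w ∈ W | e ∈ s w} ≤ 2) (X : Finset E)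
    {e : E} (heX : e ∉ X) :
    ∃ Y ⊆ X, Y ∈ testSets W s ∧ insert e Y ∈ testSets W s ∧
      splitCount W s (insert e Y) - splitCount W s Y ≤
        splitCount W s (insert e X) - splitCount W s X := by
  classical
  choose! A hA hAX hmarg using fun (w : ι) (h : w ∈ W ∧ e ∈ s w) =>
    exists_basicSet_marginal_le h.1 h.2 X heX
  -- At most two members contain `e`, and enlarging a witness within `X` keeps it valid, so the
  -- union of two basic sets serves both. The third basic set of a test set leaves room for `{e}`.
  obtain ⟨B, hB, C, hC, hBX, hCX, hBC⟩ : ∃ B ∈ basicSets W s, ∃ C ∈ basicSets W s,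
      B ⊆ X ∧ C ⊆ X ∧ ∀ w ∈ W, e ∈ s w → A w ⊆ B ∪ C := by
    have hmem : ∀ w, w ∈ W ∧ e ∈ s w ↔ w ∈ ({w ∈ W | e ∈ s w} : Finset ι) := by simp
    have hcard := hs e
    simp only [← and_imp, hmem] at hA hAX ⊢
    generalize ({w ∈ W | e ∈ s w} : Finset ι) = F at *
    interval_cases hF : #F
    · rw [Finset.card_eq_zero] at hF
      subst hF
      exact ⟨∅, empty_mem_basicSets, ∅, empty_mem_basicSets, by simp, by simp, by simp⟩
    · obtain ⟨a, rfl⟩ := Finset.card_eq_one.1 hF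
      exact ⟨A a, hA a (by simp), A a, hA a (by simp), hAX a (by simp), hAX a (by simp), by simp⟩
    · obtain ⟨a, b, -, rfl⟩ := Finset.card_eq_two.1 hF
      exact ⟨A a, hA a (by simp), A b, hA b (by simp), hAX a (by simp), hAX b (by simp), by simp⟩
  refine ⟨B ∪ C, Finset.union_subset hBX hCX, ?_, ?_, ?_⟩
  · simpa using union_mem_testSets hB hC empty_mem_basicSets
  · rw [Finset.insert_eq, Finset.union_comm]
    exact union_mem_testSets hB hC (singleton_mem_basicSets e)
  · simp only [splitCount, ← Finset.sum_sub_distrib]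
    refine Finset.sum_le_sum fun w hw => ?_
    by_cases he : e ∈ s w
    · exact hmarg w ⟨hw, he⟩ _ (hBC w hw he) (Finset.union_subset hBX hCX)
    · simp only [Finset.inter_insert_of_notMem he, Finset.sdiff_insert_of_notMem he, sub_self,
        le_refl]

/-- A normalised submodular function that vanishes on the whole set and agrees with a split count
on its test sets is equal to it. -/
theorem eq_splitCount_of_forall_testSets (hs : ∀ e, #{w ∈ W | e ∈ s w} ≤ 2)
    (f : Finset E → ℝ) (hempty : f ∅ = 0) (huniv : f univ = 0)
    (hsub : ∀ X Y, f (X ∩ Y) + f (X ∪ Y) ≤ f X + f Y)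
    (h : ∀ X ∈ testSets W s, f X = splitCount W s X) (X : Finset E) :
    f X = splitCount W s X := by
  have hmono : Monotone fun X => splitCount W s X - f X := by
    refine Finset.monotone_iff_forall_le_insert.2 fun X e heX => ?_
    obtain ⟨Y, hYX, hY, heY, hle⟩ := exists_testSet_splitCount_marginal_le hs X heX
    -- The intersection is `Y` and the union is `insert e X`, so the marginal of `e` in `f` at `X`
    -- is at most the one at `Y`.
    have h1 := hsub (insert e Y) X
    rw [Finset.insert_inter_of_notMem heX, Finset.inter_eq_left.2 hYX, Finset.insert_union,
      Finset.union_eq_right.2 hYX, h _ hY, h _ heY] at h1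
    linarith
  have h0 := hmono (Finset.empty_subset X)
  have h1 := hmono (Finset.subset_univ X)
  have h2 : splitCount W s ∅ = 0 := by simp [splitCount]
  have h3 : splitCount W s univ = 0 := by simp [splitCount]
  dsimp only at h0 h1
  linarith

end Verification

end StarFamily

/-! ### Connectivity functions of graphs as split counts -/

namespace Graph

variable {V E : Type*}

/-- The set of edges incident with `v`. -/
noncomputable def star [Fintype E] (G : Graph V E) (v : V) : Finset E := by
  classical exact {e | G.Inc e v}

lemma mem_star [Fintype E] (G : Graph V E) (v : V) (e : E) : e ∈ G.star v ↔ G.Inc e v := by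
  simp [star]

variable [Fintype E] [DecidableEq E] (G : Graph V E) (hV : G.vertexSet.Finite)

lemma card_filter_mem_star_le_two (e : E) : #{v ∈ hV.toFinset | e ∈ G.star v} ≤ 2 := by
  classical
  by_cases he : e ∈ G.edgeSet
  · obtain ⟨x, y, hxy⟩ := G.exists_isLink_of_mem_edgeSet he
    refine (Finset.card_le_card fun v hv => ?_).trans (Finset.card_le_two (a := x) (b := y))
    rw [Finset.mem_filter, mem_star] at hv
    simpa using hv.2.eq_or_eq_of_isLink hxy
  · rw [Finset.filter_false_of_mem]
    · simp
    · intro v _ hv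
      exact he ((G.mem_star v e).1 hv).edge_mem

lemma ncard_verticesOf (X : Finset E) :
    ((G.verticesOf (X : Set E)).ncard : ℝ) =
      ∑ v ∈ hV.toFinset, if (G.star v ∩ X).Nonempty then 1 else 0 := by
  rw [← Finset.natCast_card_filter, ← Set.ncard_coe_finset]
  congr 2
  ext v
  rw [Finset.mem_coe, Finset.mem_filter, Set.Finite.mem_toFinset]
  simp only [verticesOf, Set.mem_ofPred_eq, Finset.Nonempty, Finset.mem_inter, mem_star,
    Finset.mem_coe]
  constructor
  · rintro ⟨e, he, hev⟩
    exact ⟨hev.vertex_mem, e, hev, he⟩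
  · rintro ⟨-, e, hev, he⟩
    exact ⟨e, he, hev⟩

/-- A vertex contributes `1 + 1 - 1` if its star is split, `1 - 1` if its star is nonempty and lies
on one side, and 0 if its star is empty. -/
lemma connectivityFunction_eq_splitCount (X : Finset E) :
    G.connectivityFunction (X : Set E) = StarFamily.splitCount hV.toFinset G.star X := by
  rw [connectivityFunction, ← Finset.coe_compl, ← Finset.coe_univ, G.ncard_verticesOf hV,
    G.ncard_verticesOf hV, G.ncard_verticesOf hV, ← Finset.sum_add_distrib,
    ← Finset.sum_sub_distrib]
  refine Finset.sum_congr rfl fun v _ => ?_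
  rw [Finset.inter_univ, ← Finset.sdiff_eq_inter_compl]
  by_cases h1 : (G.star v ∩ X).Nonempty
  · have : (G.star v).Nonempty := h1.mono Finset.inter_subset_left
    by_cases h2 : (G.star v \ X).Nonempty <;> simp [h1, h2, this]
  · by_cases h2 : (G.star v \ X).Nonempty
    · simp [h1, h2, h2.mono Finset.sdiff_subset]
    · have : ¬ (G.star v).Nonempty := by
        rw [← Finset.sdiff_union_inter (G.star v) X, Finset.union_nonempty]
        tauto
      simp [h1, h2, this]

end Graph

namespace IsMultigraphic

variable {E : Type*} [Fintype E] [DecidableEq E]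

lemma eq_of_forall_card_le_three {lam mu : Set E → ℝ} (hlam : IsMultigraphic lam)
    (hmu : IsMultigraphic mu) (h : ∀ X : Finset E, #X ≤ 3 → lam X = mu X) : lam = mu := by
  classical
  obtain ⟨V, G, hV, -, rfl⟩ := hlam
  obtain ⟨V', G', hV', -, rfl⟩ := hmu
  funext X
  rw [← Set.coe_toFinset X, G.connectivityFunction_eq_splitCount hV,
    G'.connectivityFunction_eq_splitCount hV']
  refine StarFamily.splitCount_eq_of_forall_card_le_three (G.card_filter_mem_star_le_two hV)
    (G'.card_filter_mem_star_le_two hV') (fun X hX => ?_) _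
  rw [← G.connectivityFunction_eq_splitCount hV, ← G'.connectivityFunction_eq_splitCount hV',
    h X hX]

lemma exists_testSets {mu : Set E → ℝ} (hmu : IsMultigraphic mu) :
    ∃ Q : Finset (Finset E), #Q ≤ (3 * Fintype.card E + 1) ^ 3 ∧
      ∀ lam : Set E → ℝ, IsConnectivityFunction lam → (∀ X ∈ Q, lam X = mu X) → lam = mu := by
  classical
  obtain ⟨V, G, hV, -, rfl⟩ := hmu
  have hs := G.card_filter_mem_star_le_two hV
  refine ⟨_, StarFamily.card_testSets_le hs, fun lam hlam h => ?_⟩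
  funext X
  rw [← Set.coe_toFinset X, G.connectivityFunction_eq_splitCount hV]
  refine StarFamily.eq_splitCount_of_forall_testSets hs (fun X : Finset E => lam X) ?_ ?_ ?_ ?_ _
  · simpa using hlam.normalised
  · simpa [hlam.normalised] using hlam.symmetric Set.univ
  · intro X Y
    simpa using hlam.submodular X Y
  · intro X hX
    rw [← G.connectivityFunction_eq_splitCount hV]
    exact h X hX

end IsMultigraphic

lemma IsSimpleGraphic.isMultigraphic {E : Type*} {lam : Set E → ℝ} (h : IsSimpleGraphic lam) :
    IsMultigraphic lam := by
  obtain ⟨V, G, hV, hE, -, hlam⟩ := h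
  exact ⟨V, G, hV, hE, hlam⟩

/-! ### The decision procedure -/

namespace EvaluationTree

variable {E : Type*}

/-- Evaluate at all sets of a list and continue depending on the list of values. -/
def evaluateList : List (Set E) → (List ℝ → EvaluationTree E) → EvaluationTree E
  | [], k => k []
  | X :: L, k => evaluate X fun r => evaluateList L fun rs => k (r :: rs)

lemma run_evaluateList (lam : Set E → ℝ) (L : List (Set E)) (k : List ℝ → EvaluationTree E) :
    (evaluateList L k).run lam = (k (L.map lam)).run lam := by
  induction L generalizing k with
  | nil => rfl
  | cons X L ih => simp only [evaluateList, run, ih, List.map_cons]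

lemma numEvaluations_evaluateList (lam : Set E → ℝ) (L : List (Set E))
    (k : List ℝ → EvaluationTree E) :
    (evaluateList L k).numEvaluations lam = (k (L.map lam)).numEvaluations lam + L.length := by
  induction L generalizing k with
  | nil => rfl
  | cons X L ih =>
    simp only [evaluateList, numEvaluations, ih, List.map_cons, List.length_cons, add_assoc]

/-- If the functions with property `P` are told apart by their values on `L`, and every one of
them is told apart from all other connectivity functions by its values on a list of length at
most `k`, then `P` can be decided with `L.length + k` evaluations. -/
theorem exists_decides (P : (Set E → ℝ) → Prop) (L : List (Set E)) (k : ℕ)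
    (hL : ∀ lam mu, P lam → P mu → (∀ X ∈ L, lam X = mu X) → lam = mu)
    (hP : ∀ mu, P mu → ∃ Q : List (Set E), Q.length ≤ k ∧
      ∀ lam, IsConnectivityFunction lam → (∀ X ∈ Q, lam X = mu X) → lam = mu) :
    ∃ T : EvaluationTree E, T.Decides P (L.length + k) := by
  classical
  choose! Q hQk hQ using hP
  refine ⟨evaluateList L fun rs =>
    -- The candidate depends only on the recorded values, so a classical choice gives a legitimate
    -- procedure. If `lam` has `P`, it must be this candidate.
    if h : ∃ mu, P mu ∧ L.map mu = rs then
      evaluateList (Q h.choose) fun qs => answer (decide (qs = (Q h.choose).map h.choose))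
    else answer false, fun lam hlam => ?_⟩
  rw [run_evaluateList, numEvaluations_evaluateList]
  by_cases h : ∃ mu, P mu ∧ L.map mu = L.map lam
  · obtain ⟨hmu, hmap⟩ := h.choose_spec
    simp only [dif_pos h]
    rw [run_evaluateList, numEvaluations_evaluateList]
    generalize h.choose = mu at *
    refine ⟨?_, by
      have := hQk mu hmu
      simp only [numEvaluations]
      omega⟩
    simp only [run, decide_eq_true_eq]
    constructor
    · intro heq
      rwa [hQ mu hmu lam hlam (List.map_inj_left.1 heq)]
    · intro hPlam
      rw [hL mu lam hmu hPlam (List.map_inj_left.1 hmap)]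
  · simp only [dif_neg h]
    refine ⟨?_, by simp [numEvaluations]⟩
    simp only [run, Bool.false_eq_true, false_iff]
    exact fun hPlam => h ⟨lam, hPlam, rfl⟩

/-- A property that implies being multigraphic can be decided with polynomially many
evaluations. -/
theorem exists_decides_of_isMultigraphic [Finite E] (P : (Set E → ℝ) → Prop)
    (hP : ∀ lam, P lam → IsMultigraphic lam) :
    ∃ T : EvaluationTree E,
      T.Decides P (2 * (3 * Nat.card E + 1) ^ 3) := by
  classical
  have := Fintype.ofFinite E
  rw [Nat.card_eq_fintype_card]
  -- The test sets of the empty family include all sets of size at most three, so the same cubic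
  -- bound covers the first round; hence the factor 2.
  have hsmall : #(StarFamily.testSets (∅ : Finset E) fun _ => (∅ : Finset E)) ≤
      (3 * Fintype.card E + 1) ^ 3 :=
    StarFamily.card_testSets_le (by simp)
  obtain ⟨T, hT⟩ := exists_decides P
    ((StarFamily.testSets (∅ : Finset E) fun _ => (∅ : Finset E)).toList.map fun X : Finset E => (X : Set E))
    ((3 * Fintype.card E + 1) ^ 3)
    (fun lam mu hlam hmu h => (hP lam hlam).eq_of_forall_card_le_three (hP mu hmu) fun X hX =>
      h X (List.mem_map.2 ⟨X, Finset.mem_toList.2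
        (StarFamily.mem_testSets_of_card_le_three X hX), rfl⟩))
    (fun mu hmu => by
      obtain ⟨Q, hQcard, hQ⟩ := (hP mu hmu).exists_testSets
      refine ⟨Q.toList.map fun X : Finset E => (X : Set E), by simpa using hQcard,
        fun lam hlam h => hQ lam hlam fun X hX => ?_⟩
      exact h X (List.mem_map.2 ⟨X, Finset.mem_toList.2 hX, rfl⟩))
  refine ⟨T, fun lam hlam => ⟨(hT lam hlam).1, (hT lam hlam).2.trans ?_⟩⟩
  rw [List.length_map, Finset.length_toList]
  omega

end EvaluationTree

theorem theorem1 :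
    ∃ p : Polynomial ℕ, ∀ (E : Type*) [Finite E],
      (∃ T : EvaluationTree E, T.Decides IsSimpleGraphic (p.eval (Nat.card E))) ∧
      (∃ T : EvaluationTree E, T.Decides IsMultigraphic (p.eval (Nat.card E))) := by
  refine ⟨2 * (3 * Polynomial.X + 1) ^ 3, fun E _ => ?_⟩
  have heval : (2 * (3 * Polynomial.X + 1) ^ 3 : Polynomial ℕ).eval (Nat.card E) =
      2 * (3 * Nat.card E + 1) ^ 3 := by simp
  rw [heval]
  exact ⟨EvaluationTree.exists_decides_of_isMultigraphic _ fun _ h => h.isMultigraphic,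
    EvaluationTree.exists_decides_of_isMultigraphic _ fun _ h => h⟩
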